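/- **Theorem 1.3.** Let $\mathcal X$ be a finite set of size $N \ge 2$. Let $\mathcal R_N$ be the set of $N\times N$ Markov transition matrices (row-stochastic matrices) on $\mathcal X$ that are reversible with respect to a stationary distribution $\pi$ with $\pi(x)>0$ for all $x\in\mathcal X$, i.e. $\pi(x)P(x,y)=\pi(y)P(y,x)$ for all $x,y$; let $\overline{\mathcal R_N}$ be its closure in $\mathbb R^{N^2}$. Let $P\in\overline{\mathcal R_N}$, and let $\beta_1,\dots,\beta_N$, with $\beta_N=1$, be its eigenvalues counted with algebraic multiplicity. Put $\beta_\star=\max\{|\beta_j| : 1\le j\le N-1\}$, assume $\beta_\star<1$, and let $t_{\mathrm{rel}}=1/(1-\beta_\star)$. Then $P$ has a unique stationary distribution $\pi$, and for every $0<\varepsilon<1$ the mixing time $$t_{\mathrm{mix}}(\varepsilon)=\min\Big\{t\in\mathbb Z_{\ge 0} : \tfrac12\sum_{y\in\mathcal X}|P^t(x,y)-\pi(y)|\le\varepsilon\ \text{ for all } x\in\mathcal X\Big\}$$ exists (the set is non-empty) and satisfies $$t_{\mathrm{mix}}(\varepsilon)\le 2\Big(N+2\log\varepsilon^{-1}-1+\sqrt{2(N-2)\log\varepsilon^{-1}}\Big)\,t_{\mathrm{rel}}.$$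 If moreover all eigenvalues of $P$ are nonnegative real numbers, then $$t_{\mathrm{mix}}(\varepsilon)\le \Big(N+2\log\varepsilon^{-1}-1+\sqrt{2(N-2)\log\varepsilon^{-1}}\Big)\,t_{\mathrm{rel}}.$$ -/

import Mathlib

namespace MarkovMixing

noncomputable section

variable {X : Type*} [Fintype X] [DecidableEq X]

/-- `π` is a stationary distribution of `P`: a probability vector with `π P = π`. -/
def IsStationary (P : Matrix X X ℝ) (π : X → ℝ) : Prop :=
  π ∈ stdSimplex ℝ X ∧ Matrix.vecMul π P = π

/-- Detailed balance: `P` is reversible with respect to `π`. -/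
def IsReversible (P : Matrix X X ℝ) (π : X → ℝ) : Prop :=
  ∀ x y, π x * P x y = π y * P y x

variable (X) in
/-- Transition matrices on `X` that are reversible with respect to an everywhere positive
stationary distribution. -/
def reversibleChains : Set (Matrix X X ℝ) :=
  {P | P ∈ Matrix.rowStochastic ℝ X ∧
    ∃ π : X → ℝ, IsStationary P π ∧ (∀ x, 0 < π x) ∧ IsReversible P π}

/-- The complex eigenvalues of `P`, listed with algebraic multiplicity. -/
def eigenvalues (P : Matrix X X ℝ) : Multiset ℂ :=
  (P.map (algebraMap ℝ ℂ)).charpoly.roots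

/-- The largest modulus of an eigenvalue, after one copy of the eigenvalue `1` is removed
from the list (`0` if nothing remains). -/
def betaStar (P : Matrix X X ℝ) : ℝ :=
  ((((eigenvalues P).erase 1).map (fun z : ℂ => ‖z‖₊)).sup : NNReal)

/-- The relaxation time; used only when `betaStar P < 1`. -/
def tRel (P : Matrix X X ℝ) : ℝ :=
  1 / (1 - betaStar P)

/-- Total variation distance of two probability vectors. -/
def tvDist (μ ν : X → ℝ) : ℝ :=
  (1 / 2) * ∑ x, |μ x - ν x|

/-- The times `t` at which `P ^ t` is, from every starting state, within `ε` of `π`. -/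
def mixedTimes (P : Matrix X X ℝ) (π : X → ℝ) (ε : ℝ) : Set ℕ :=
  {t | ∀ x, tvDist ((P ^ t) x) π ≤ ε}

/-- The mixing time: the least element of `mixedTimes P π ε`. -/
def tMix (P : Matrix X X ℝ) (π : X → ℝ) (ε : ℝ) : ℕ :=
  sInf (mixedTimes P π ε)

end

end MarkovMixing

/-! The proof uses Micchelli–Willoughby positivity. For a nonnegative symmetric matrix with
eigenvalues `lam 0 ≥ lam 1 ≥ ...`, the products of `A - lam i` over the smallest eigenvalues are
entrywise nonnegative. They are the coefficients of the adjugate of `X - A` in the Newton basis at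
the `lam i`. Induction on the size, deleting one index and using Cauchy interlacing, makes these
coefficients nonnegative (`adjugate_charmatrix_inNewtonCone`).

Conjugation by the square root of `π` transfers this to reversible chains. Diagonalizability may
fail in the closure, but the sign conditions survive limits because the eigenvalue lists range over
a compact set (`isClosed_exists_isSpectralData`).

Normalized to row sum 1, the products are stochastic matrices `L k` (`localEq`), with `L N = 1` and
every row of `L 1` equal to `π`. They satisfy `P * L (k+1) = lam k • L (k+1) + (1 - lam k) • L k`.
If the eigenvalues are nonnegative, this describes a pure death chain on levels `N, ..., 1` with
holding probabilities `lam k`. The distance to `π` at time `t` is at most the probability that level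
1 has not been reached. That means at most `N - 2` deaths in `t` steps, each of probability at least
`1 - β`, and a Chernoff bound applies. For signed eigenvalues the argument is run on `P * P`, which
costs the factor 2. -/

namespace MarkovMixing

open Polynomial Finset Matrix

/-! ### Newton bases -/

/-- The Newton polynomial `∏ i < k, (X - lam i)`. -/
noncomputable def newtonPoly (lam : ℕ → ℝ) (k : ℕ) : ℝ[X] :=
  ∏ i ∈ range k, (X - C (lam i))

theorem newtonPoly_zero (lam : ℕ → ℝ) : newtonPoly lam 0 = 1 := by simp [newtonPoly]

theorem newtonPoly_succ (lam : ℕ → ℝ) (k : ℕ) :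
    newtonPoly lam (k + 1) = newtonPoly lam k * (X - C (lam k)) := by
  simp [newtonPoly, prod_range_succ]

theorem newtonPoly_monic (lam : ℕ → ℝ) (k : ℕ) : (newtonPoly lam k).Monic :=
  monic_prod_of_monic _ _ fun _ _ => monic_X_sub_C _

theorem newtonPoly_natDegree (lam : ℕ → ℝ) (k : ℕ) : (newtonPoly lam k).natDegree = k := by
  simp [newtonPoly, natDegree_prod_of_monic _ _ fun i _ => monic_X_sub_C (lam i)]

/-- Coefficients with respect to a Newton basis are unique. -/
theorem newton_coeff_eq_zero (lam : ℕ → ℝ) (m : ℕ) (c : ℕ → ℝ)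
    (h : ∑ k ∈ range m, C (c k) * newtonPoly lam k = 0) : ∀ k < m, c k = 0 := by
  induction m with
  | zero => intro k hk; omega
  | succ m ih =>
    have hlow : ∀ j ∈ range m, (C (c j) * newtonPoly lam j).coeff m = 0 := by
      intro j hj
      rw [coeff_C_mul, coeff_eq_zero_of_natDegree_lt, mul_zero]
      rw [newtonPoly_natDegree]
      exact mem_range.1 hj
    have hm : c m = 0 := by
      have := congrArg (fun p => coeff p m) h
      simp only [finsetSum_coeff, coeff_zero] at this
      rw [sum_range_succ, sum_eq_zero hlow, zero_add, coeff_C_mul] at this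
      have h1 : (newtonPoly lam m).coeff m = 1 := by
        have := newtonPoly_monic lam m
        rwa [Monic, leadingCoeff, newtonPoly_natDegree] at this
      rwa [h1, mul_one] at this
    rw [sum_range_succ, hm, C_0, zero_mul, add_zero] at h
    intro k hk
    rcases Nat.lt_succ_iff_lt_or_eq.1 hk with h' | rfl
    · exact ih h k h'
    · exact hm

/-- The polynomial `p` is a nonnegative combination of the first `m` Newton polynomials. -/
def InNewtonCone (lam : ℕ → ℝ) (m : ℕ) (p : ℝ[X]) : Prop :=
  ∃ c : ℕ → ℝ, (∀ k, 0 ≤ c k) ∧ p = ∑ k ∈ range m, C (c k) * newtonPoly lam k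

namespace InNewtonCone

variable {lam mu : ℕ → ℝ} {m : ℕ} {p q : ℝ[X]}

theorem zero : InNewtonCone lam m 0 := ⟨0, fun _ => le_rfl, by simp⟩

theorem add (hp : InNewtonCone lam m p) (hq : InNewtonCone lam m q) :
    InNewtonCone lam m (p + q) := by
  obtain ⟨c, hc, rfl⟩ := hp
  obtain ⟨d, hd, rfl⟩ := hq
  exact ⟨fun k => c k + d k, fun k => add_nonneg (hc k) (hd k), by
    simp [add_mul, sum_add_distrib]⟩

theorem C_mul {a : ℝ} (ha : 0 ≤ a) (hp : InNewtonCone lam m p) :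
    InNewtonCone lam m (C a * p) := by
  obtain ⟨c, hc, rfl⟩ := hp
  exact ⟨fun k => a * c k, fun k => mul_nonneg ha (hc k), by simp [mul_sum, mul_assoc]⟩

theorem sum {ι : Type*} (s : Finset ι) (f : ι → ℝ[X]) (h : ∀ i ∈ s, InNewtonCone lam m (f i)) :
    InNewtonCone lam m (∑ i ∈ s, f i) := by
  classical
  induction s using Finset.induction_on with
  | empty => simpa using zero
  | insert i s hi ih =>
    rw [sum_insert hi]
    exact (h i (mem_insert_self i s)).add (ih fun j hj => h j (mem_insert_of_mem hj))

theorem newtonPoly {k : ℕ} (hk : k < m) : InNewtonCone lam m (newtonPoly lam k) := by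
  refine ⟨fun j => if j = k then 1 else 0, fun j => by dsimp only; split_ifs <;> simp, ?_⟩
  rw [sum_eq_single_of_mem k (mem_range.2 hk)]
  · simp
  · intro j _ hj; simp [hj]

theorem mono {m' : ℕ} (hm : m ≤ m') (hp : InNewtonCone lam m p) : InNewtonCone lam m' p := by
  obtain ⟨c, hc, rfl⟩ := hp
  exact sum _ _ fun k hk => C_mul (hc k) (newtonPoly (lt_of_lt_of_le (mem_range.1 hk) hm))

/-- Write `X - a = (X - lam k) + (lam k - a)`: the first summand raises the Newton index, the second
is a nonnegative scalar. -/
theorem X_sub_C_mul {a : ℝ} (ha : ∀ k < m, a ≤ lam k) (hp : InNewtonCone lam m p) :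
    InNewtonCone lam (m + 1) (p * (X - C a)) := by
  obtain ⟨c, hc, rfl⟩ := hp
  rw [sum_mul]
  refine sum _ _ fun k hk => ?_
  have hk' := mem_range.1 hk
  have : C (c k) * MarkovMixing.newtonPoly lam k * (X - C a) =
      C (c k) * (MarkovMixing.newtonPoly lam (k + 1) +
        C (lam k - a) * MarkovMixing.newtonPoly lam k) := by
    rw [newtonPoly_succ, C_sub]; ring
  rw [this]
  exact C_mul (hc k) ((newtonPoly (by omega)).add
    (C_mul (sub_nonneg.2 (ha k hk')) (newtonPoly (by omega))))

/-- Newton polynomials for dominated nodes lie in the cone. -/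
theorem newtonPoly_of_le (hlam : AntitoneOn lam (Set.Iio m)) {k : ℕ} (hk : k < m + 1)
    (h : ∀ i < k, mu i ≤ lam i) :
    InNewtonCone lam (k + 1) (MarkovMixing.newtonPoly mu k) := by
  induction k with
  | zero =>
    rw [newtonPoly_zero, ← newtonPoly_zero lam]
    exact newtonPoly (by omega)
  | succ k ih =>
    rw [newtonPoly_succ]
    refine X_sub_C_mul (fun j hj => (h k (by omega)).trans ?_)
      (ih (by omega) fun i hi => h i (by omega))
    exact hlam (by simp; omega) (by simp; omega) (by omega)

theorem of_le (hlam : AntitoneOn lam (Set.Iio (m + 1))) (h : ∀ i < m, mu i ≤ lam i)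
    (hp : InNewtonCone mu m p) : InNewtonCone lam (m + 1) p := by
  obtain ⟨c, hc, rfl⟩ := hp
  refine sum _ _ fun k hk => C_mul (hc k) ?_
  have hk' := mem_range.1 hk
  exact mono (by omega) (newtonPoly_of_le hlam (by omega) fun i hi => h i (by omega))

/-- Cone membership only provides some nonnegative coefficients; uniqueness of Newton expansions
identifies them with the given ones. -/
theorem coeff_nonneg (hp : InNewtonCone lam m p) {d : ℕ → ℝ}
    (hd : p = ∑ k ∈ range m, C (d k) * MarkovMixing.newtonPoly lam k) {k : ℕ} (hk : k < m) :
    0 ≤ d k := by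
  obtain ⟨c, hc, hp⟩ := hp
  have := newton_coeff_eq_zero lam m (fun k => d k - c k) (by
    simp only [C_sub, sub_mul, sum_sub_distrib, ← hd, ← hp, sub_self]) k hk
  linarith [hc k]

end InNewtonCone

/-! ### Adjugates of characteristic matrices -/

section Adjugate

variable {ι : Type*} [Fintype ι] [DecidableEq ι]

/-- The tail products `∏ k ≤ i < n, (X - lam i)`. -/
noncomputable def tailPoly (lam : ℕ → ℝ) (n k : ℕ) : ℝ[X] :=
  ∏ i ∈ Ico k n, (X - C (lam i))

theorem tailPoly_self (lam : ℕ → ℝ) (n : ℕ) : tailPoly lam n n = 1 := by simp [tailPoly]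

theorem tailPoly_zero (lam : ℕ → ℝ) (n : ℕ) : tailPoly lam n 0 = newtonPoly lam n := by
  simp [tailPoly, newtonPoly]

theorem tailPoly_eq_mul (lam : ℕ → ℝ) {n k : ℕ} (hk : k < n) :
    tailPoly lam n k = (X - C (lam k)) * tailPoly lam n (k + 1) := by
  rw [tailPoly, prod_eq_prod_Ico_succ_bot hk]; rfl

theorem newtonPoly_eq_mul_tailPoly (lam : ℕ → ℝ) {n : ℕ} (hn : 0 < n) :
    newtonPoly lam n = (X - C (lam 0)) * tailPoly lam n 1 := by
  rw [← tailPoly_zero, tailPoly_eq_mul lam hn]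

theorem eval_tailPoly (lam : ℕ → ℝ) (n k : ℕ) (z : ℝ) :
    (tailPoly lam n k).eval z = ∏ i ∈ Ico k n, (z - lam i) := by
  simp [tailPoly, eval_prod]

theorem aeval_tailPoly_eq_mul (A : Matrix ι ι ℝ) (lam : ℕ → ℝ) {n k : ℕ} (hk : k < n) :
    aeval A (tailPoly lam n k) =
      (A - algebraMap ℝ _ (lam k)) * aeval A (tailPoly lam n (k + 1)) := by
  rw [tailPoly_eq_mul lam hk]; simp

/-- Expansion of the adjugate of the characteristic matrix in a Newton basis at the eigenvalues. -/
theorem adjugate_charmatrix_apply (A : Matrix ι ι ℝ) (lam : ℕ → ℝ) (n : ℕ)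
    (hA : A.charpoly = newtonPoly lam n) (x y : ι) :
    (adjugate (charmatrix A)) x y =
      ∑ k ∈ range n, C ((aeval A (tailPoly lam n (k + 1))) x y) * newtonPoly lam k := by
  set u : ℕ → Matrix ι ι ℝ[X] := fun k =>
    newtonPoly lam k • (aeval A (tailPoly lam n k)).map C with hu
  set G : Matrix ι ι ℝ[X] := ∑ k ∈ range n,
    newtonPoly lam k • (aeval A (tailPoly lam n (k + 1))).map C with hG
  -- The summands telescope: the total is the charpoly minus its value at `A`, which vanishes by
  -- Cayley–Hamilton.
  have hstep : ∀ k ∈ range n, charmatrix A *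
      (newtonPoly lam k • (aeval A (tailPoly lam n (k + 1))).map C) = u (k + 1) - u k := by
    intro k hk
    simp only [hu]
    rw [aeval_tailPoly_eq_mul A lam (mem_range.1 hk), newtonPoly_succ]
    set M := aeval A (tailPoly lam n (k + 1))
    have h1 : ((A - algebraMap ℝ _ (lam k)) * M).map C =
        (A.map C - C (lam k) • (1 : Matrix ι ι ℝ[X])) * M.map C := by
      rw [Matrix.map_mul]
      congr 1
      ext i j
      by_cases hij : i = j
      · subst hij; simp [Matrix.algebraMap_matrix_apply]
      · simp [Matrix.algebraMap_matrix_apply, hij]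
    have h2 : charmatrix A = (X : ℝ[X]) • (1 : Matrix ι ι ℝ[X]) - A.map C := by
      ext i j
      by_cases hij : i = j
      · subst hij; simp
      · simp [hij]
    rw [h1, h2]
    simp only [sub_mul, mul_smul_comm, smul_mul_assoc, one_mul, smul_sub, smul_smul]
    module
  have hprod : charmatrix A * G = A.charpoly • (1 : Matrix ι ι ℝ[X]) := by
    rw [hG, mul_sum, sum_congr rfl hstep, sum_range_sub]
    simp only [hu]
    rw [tailPoly_zero, ← hA, aeval_self_charpoly, tailPoly_self]
    simp
  have hadj : A.charpoly • adjugate (charmatrix A) = A.charpoly • G := by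
    have := congrArg (fun M => adjugate (charmatrix A) * M) hprod
    simp only [← mul_assoc, adjugate_mul, mul_smul_comm, mul_one, smul_mul_assoc, one_mul] at this
    rw [← this]; rfl
  have hne : A.charpoly ≠ 0 := A.charpoly_monic.ne_zero
  have := congrFun (congrFun hadj x) y
  simp only [Matrix.smul_apply, smul_eq_mul] at this
  rw [mul_left_cancel₀ hne this, hG, Matrix.sum_apply]
  refine sum_congr rfl fun k _ => ?_
  simp [mul_comm]

/-- Expansion of an off-diagonal entry of an adjugate along a deleted principal index. -/
theorem adjugate_apply_succAbove {R : Type*} [CommRing R] [IsDomain R] {n : ℕ}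
    (M : Matrix (Fin (n + 1)) (Fin (n + 1)) R) (x : Fin (n + 1)) (hM : M.det ≠ 0)
    (hD : (M.submatrix x.succAbove x.succAbove).det ≠ 0) (w : Fin n) :
    adjugate M x (x.succAbove w) =
      -∑ j, M x (x.succAbove j) * adjugate (M.submatrix x.succAbove x.succAbove) j w := by
  set D := M.submatrix x.succAbove x.succAbove with hDdef
  set b : Fin n → R := fun j => M x (x.succAbove j) with hb
  -- Block elimination: `v` kills every column of `M` except column `x`, so it is proportional to
  -- row `x` of the adjugate. Comparing entries at `x` fixes the factor.
  set v : Fin (n + 1) → R := x.insertNth D.det (-(b ᵥ* adjugate D)) with hv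
  have hvx : v x = D.det := by simp [hv]
  have hvw : ∀ w, v (x.succAbove w) = -(b ᵥ* adjugate D) w := by simp [hv]
  set δ := (v ᵥ* M) x with hδ
  have hvM : v ᵥ* M = Pi.single x δ := by
    ext y
    rcases Fin.eq_self_or_eq_succAbove x y with rfl | ⟨z, rfl⟩
    · simp [hδ]
    · rw [Pi.single_eq_of_ne (Fin.succAbove_ne x z)]
      have h1 : (b ᵥ* adjugate D) ᵥ* D = D.det • b := by
        rw [vecMul_vecMul, adjugate_mul, vecMul_smul, vecMul_one]
      have h2 := congrFun h1 z
      simp only [vecMul, dotProduct, Pi.smul_apply, smul_eq_mul] at h2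
      simp only [vecMul, dotProduct]
      rw [Fin.sum_univ_succAbove _ x, hvx]
      simp only [hvw, neg_mul, sum_neg_distrib]
      simp only [vecMul, dotProduct]
      rw [← sub_eq_add_neg, sub_eq_zero]
      exact h2.symm
  have hrow : ∀ y, M.det * v y = δ * adjugate M x y := by
    intro y
    have h1 : (v ᵥ* M) ᵥ* adjugate M = M.det • v := by
      rw [vecMul_vecMul, mul_adjugate, vecMul_smul, vecMul_one]
    rw [hvM] at h1
    have h2 := congrFun h1 y
    simp at h2
    exact h2.symm
  have hxx : adjugate M x x = D.det := by
    rw [adjugate_fin_succ_eq_det_submatrix, ← two_mul, pow_mul]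
    simp [hDdef]
  have hδdet : M.det = δ := by
    have := hrow x
    rw [hvx, hxx] at this
    exact mul_right_cancel₀ hD this
  have := hrow (x.succAbove w)
  rw [← hδdet] at this
  rw [← mul_left_cancel₀ hM this, hvw]
  simp [vecMul, dotProduct, hb]

end Adjugate

end MarkovMixing

namespace MarkovMixing

open Polynomial Finset Matrix

/-! ### Cauchy interlacing -/

section Interlacing

variable {E F : Type*} [NormedAddCommGroup E] [InnerProductSpace ℝ E] [FiniteDimensional ℝ E]
  [NormedAddCommGroup F] [InnerProductSpace ℝ F] [FiniteDimensional ℝ F]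

theorem inner_apply_self_eq_sum {T : E →ₗ[ℝ] E} {n : ℕ} (hT : T.IsSymmetric)
    (hn : Module.finrank ℝ E = n) (v : E) :
    inner ℝ v (T v) =
      ∑ i, hT.eigenvalues hn i * (inner ℝ (hT.eigenvectorBasis hn i) v) ^ 2 := by
  rw [← (hT.eigenvectorBasis hn).sum_inner_mul_inner v (T v)]
  refine sum_congr rfl fun i _ => ?_
  rw [← hT, hT.apply_eigenvectorBasis hn i, inner_smul_left, real_inner_comm v]
  simp
  ring

/-- The ordered eigenvalues of a compression of a symmetric operator are dominated by those of
the operator. -/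
theorem eigenvalues_le_of_isometry {T : E →ₗ[ℝ] E} {S : F →ₗ[ℝ] F} {n m : ℕ}
    (hT : T.IsSymmetric) (hS : S.IsSymmetric) (hn : Module.finrank ℝ E = n)
    (hm : Module.finrank ℝ F = m) (J : F →ₗᵢ[ℝ] E)
    (hJ : ∀ v, inner ℝ (J v) (T (J v)) = inner ℝ v (S v)) (i : Fin m) (j : Fin n)
    (hij : (i : ℕ) = j) : hS.eigenvalues hm i ≤ hT.eigenvalues hn j := by
  set e := hT.eigenvectorBasis hn
  set f := hS.eigenvectorBasis hm
  -- Since `i = j`, these are `m - 1` linear conditions on an `m`-dimensional space. A nonzero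
  -- solution has Rayleigh quotient at least the `i`th eigenvalue of `S` and at most the `j`th of
  -- `T`.
  let φ : F →ₗ[ℝ] (Fin j → ℝ) × (Fin (m - 1 - i) → ℝ) :=
    (LinearMap.pi fun k : Fin j => (innerₛₗ ℝ (e ⟨k, k.2.trans j.2⟩)).comp J.toLinearMap).prod
      (LinearMap.pi fun l : Fin (m - 1 - i) => innerₛₗ ℝ (f ⟨i + 1 + l, by omega⟩))
  have hker : LinearMap.ker φ ≠ ⊥ := by
    apply LinearMap.ker_ne_bot_of_finrank_lt
    rw [Module.finrank_prod, Module.finrank_fin_fun, Module.finrank_fin_fun, hm]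
    have := i.2
    omega
  obtain ⟨v, hv, hv0⟩ := Submodule.exists_mem_ne_zero_of_ne_bot hker
  rw [LinearMap.mem_ker] at hv
  have hlow : ∀ k : Fin n, k < j → inner ℝ (e k) (J v) = 0 := fun k hk => by
    have := congrFun (congrArg Prod.fst hv) ⟨k, hk⟩
    simpa [φ] using this
  have hhigh : ∀ l : Fin m, i < l → inner ℝ (f l) v = 0 := fun l hl => by
    have hl' : (i : ℕ) < l := hl
    have := congrFun (congrArg Prod.snd hv) ⟨l - (i + 1), by have := l.2; omega⟩
    have hl2 : (i : ℕ) + 1 + (l - (i + 1)) = l := by omega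
    simpa [φ, hl2] using this
  have h1 : hS.eigenvalues hm i * ‖v‖ ^ 2 ≤ inner ℝ v (S v) := by
    rw [inner_apply_self_eq_sum hS hm, ← f.sum_sq_norm_inner_right, mul_sum]
    refine sum_le_sum fun l _ => ?_
    rw [Real.norm_eq_abs, sq_abs]
    rcases le_or_gt l i with hl | hl
    · exact mul_le_mul_of_nonneg_right (hS.eigenvalues_antitone hm hl) (sq_nonneg _)
    · simp [hhigh l hl, f]
  have h2 : inner ℝ (J v) (T (J v)) ≤ hT.eigenvalues hn j * ‖v‖ ^ 2 := by
    rw [inner_apply_self_eq_sum hT hn, ← J.norm_map v, ← e.sum_sq_norm_inner_right, mul_sum]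
    refine sum_le_sum fun l _ => ?_
    rw [Real.norm_eq_abs, sq_abs]
    rcases le_or_gt j l with hl | hl
    · exact mul_le_mul_of_nonneg_right (hT.eigenvalues_antitone hn hl) (sq_nonneg _)
    · simp [hlow l hl, e]
  rw [hJ] at h2
  exact le_of_mul_le_mul_right (h1.trans h2) (by positivity)

end Interlacing

/-- The eigenvalues of a real symmetric matrix in decreasing order, extended by zero. -/
noncomputable def sortedEig {n : ℕ} (A : Matrix (Fin n) (Fin n) ℝ) (hA : A.IsHermitian) (i : ℕ) :
    ℝ :=
  if h : i < n then
    (isSymmetric_toEuclideanLin_iff.mpr hA).eigenvalues finrank_euclideanSpace_fin ⟨i, h⟩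
  else 0

theorem sortedEig_antitoneOn {n : ℕ} (A : Matrix (Fin n) (Fin n) ℝ) (hA : A.IsHermitian) :
    AntitoneOn (sortedEig A hA) (Set.Iio n) := by
  intro i hi j hj hij
  simp only [Set.mem_Iio] at hi hj
  simp only [sortedEig, hi, hj, dif_pos]
  exact LinearMap.IsSymmetric.eigenvalues_antitone _ _ hij

theorem charpoly_eq_newtonPoly_sortedEig {n : ℕ} (A : Matrix (Fin n) (Fin n) ℝ)
    (hA : A.IsHermitian) : A.charpoly = newtonPoly (sortedEig A hA) n := by
  have h := (isSymmetric_toEuclideanLin_iff.mpr hA).charpoly_eq finrank_euclideanSpace_fin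
  have h' : (toEuclideanLin A).charpoly = A.charpoly := by
    rw [show toEuclideanLin A = toLin (PiLp.basisFun 2 ℝ (Fin n)) (PiLp.basisFun 2 ℝ (Fin n)) A
      from congrArg (fun L => L A) (toLpLin_eq_toLin 2 2), charpoly_toLin]
  rw [← h', h, newtonPoly, Finset.prod_range]
  refine prod_congr rfl fun i _ => ?_
  simp [sortedEig]

/-- Extension of a vector by zero at the index `x`, as an isometry. -/
noncomputable def insertZero {n : ℕ} (x : Fin (n + 1)) :
    EuclideanSpace ℝ (Fin n) →ₗᵢ[ℝ] EuclideanSpace ℝ (Fin (n + 1)) where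
  toFun v := WithLp.toLp 2 (x.insertNth (0 : ℝ) v.ofLp)
  map_add' v w := by
    ext y
    rcases Fin.eq_self_or_eq_succAbove x y with rfl | ⟨z, rfl⟩ <;> simp
  map_smul' a v := by
    ext y
    rcases Fin.eq_self_or_eq_succAbove x y with rfl | ⟨z, rfl⟩ <;> simp
  norm_map' v := by
    simp [EuclideanSpace.norm_eq, Fin.sum_univ_succAbove _ x]

theorem sortedEig_submatrix_le {n : ℕ} (A : Matrix (Fin (n + 1)) (Fin (n + 1)) ℝ)
    (hA : A.IsHermitian) (x : Fin (n + 1)) (hB : (A.submatrix x.succAbove x.succAbove).IsHermitian)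
    (i : ℕ) (hi : i < n) :
    sortedEig (A.submatrix x.succAbove x.succAbove) hB i ≤ sortedEig A hA i := by
  simp only [sortedEig, hi, Nat.lt_succ_of_lt hi, dif_pos]
  refine eigenvalues_le_of_isometry _ _ _ _ (insertZero x) (fun v => ?_) _ _ rfl
  simp [EuclideanSpace.inner_eq_star_dotProduct, dotProduct, Fin.sum_univ_succAbove _ x, mulVec,
    insertZero, toLpLin_apply]

/-! ### The Micchelli–Willoughby theorem -/

theorem charmatrix_submatrix_of_injective {ι κ : Type*} [Fintype ι] [DecidableEq ι] [Fintype κ]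
    [DecidableEq κ] (A : Matrix ι ι ℝ) (f : κ → ι) (hf : Function.Injective f) :
    (charmatrix A).submatrix f f = charmatrix (A.submatrix f f) := by
  ext i j : 2
  by_cases h : i = j
  · subst h; simp
  · simp [charmatrix_apply_ne _ _ _ h, charmatrix_apply_ne _ _ _ (hf.ne h)]

/-- Delete index `x`. The diagonal entry is the charpoly of the principal submatrix; an off-diagonal
entry is a combination, with weights `A x j ≥ 0`, of entries covered by induction. Interlacing moves
both into the Newton cone of `A`. -/
theorem adjugate_charmatrix_inNewtonCone (n : ℕ) (A : Matrix (Fin n) (Fin n) ℝ)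
    (hA : A.IsHermitian) (hnn : ∀ x y, 0 ≤ A x y) (x y : Fin n) :
    InNewtonCone (sortedEig A hA) n (adjugate (charmatrix A) x y) := by
  induction n with
  | zero => exact x.elim0
  | succ n ih =>
    set B := A.submatrix x.succAbove x.succAbove with hBdef
    have hB : B.IsHermitian := hA.submatrix _
    have hsub : (charmatrix A).submatrix x.succAbove x.succAbove = charmatrix B :=
      charmatrix_submatrix_of_injective A _ Fin.succAbove_right_injective
    have hle : ∀ i < n, sortedEig B hB i ≤ sortedEig A hA i := fun i hi =>
      sortedEig_submatrix_le A hA x hB i hi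
    have hanti := sortedEig_antitoneOn A hA
    rcases Fin.eq_self_or_eq_succAbove x y with rfl | ⟨w, rfl⟩
    · rw [adjugate_fin_succ_eq_det_submatrix, ← two_mul, pow_mul, hsub]
      have : (charmatrix B).det = newtonPoly (sortedEig B hB) n :=
        charpoly_eq_newtonPoly_sortedEig B hB
      rw [this]
      simpa using InNewtonCone.newtonPoly_of_le hanti (by omega) hle
    · rw [adjugate_apply_succAbove (charmatrix A) x A.charpoly_monic.ne_zero
        (by rw [hsub]; exact B.charpoly_monic.ne_zero), hsub, ← sum_neg_distrib]
      refine InNewtonCone.sum _ _ fun j _ => ?_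
      rw [charmatrix_apply_ne _ _ _ (Fin.succAbove_ne x j).symm, neg_mul, neg_neg]
      exact InNewtonCone.C_mul (hnn _ _)
        (InNewtonCone.of_le hanti hle (ih B hB (fun _ _ => hnn _ _) j w))

/-- **Micchelli–Willoughby**: for a nonnegative symmetric matrix, the products of `A - lam i` over
the smallest eigenvalues are entrywise nonnegative. -/
theorem aeval_tailPoly_nonneg {n : ℕ} (A : Matrix (Fin n) (Fin n) ℝ)
    (hA : A.IsHermitian) (hnn : ∀ x y, 0 ≤ A x y) {k : ℕ} (hk : k < n) (x y : Fin n) :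
    0 ≤ aeval A (tailPoly (sortedEig A hA) n (k + 1)) x y :=
  (adjugate_charmatrix_inNewtonCone n A hA hnn x y).coeff_nonneg
    (d := fun k => aeval A (tailPoly (sortedEig A hA) n (k + 1)) x y)
    (adjugate_charmatrix_apply A _ n (charpoly_eq_newtonPoly_sortedEig A hA) x y) hk

end MarkovMixing

namespace MarkovMixing

open Polynomial Finset Matrix

variable {X : Type*} [Fintype X] [DecidableEq X]

/-! ### Spectral data of chains in the closure of the reversible chains -/

/-- `lam` lists the eigenvalues of the transition matrix `P` in decreasing order, and the products
of `P - lam i` over the smallest eigenvalues are entrywise nonnegative. -/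
structure IsSpectralData (P : Matrix X X ℝ) (lam : ℕ → ℝ) : Prop where
  stochastic : P ∈ rowStochastic ℝ X
  mem_Icc : ∀ i, lam i ∈ Set.Icc (-1 : ℝ) 1
  antitoneOn : AntitoneOn lam (Set.Iio (Fintype.card X))
  charpoly_eq : P.charpoly = newtonPoly lam (Fintype.card X)
  nonneg : ∀ k < Fintype.card X, ∀ x y,
    0 ≤ aeval P (tailPoly lam (Fintype.card X) (k + 1)) x y

theorem isRoot_newtonPoly (lam : ℕ → ℝ) {n i : ℕ} (hi : i < n) :
    (newtonPoly lam n).IsRoot (lam i) := by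
  rw [newtonPoly, IsRoot, eval_prod]
  exact prod_eq_zero (mem_range.2 hi) (by simp)

theorem exists_eq_of_isRoot_newtonPoly {lam : ℕ → ℝ} {n : ℕ} {z : ℝ}
    (h : (newtonPoly lam n).IsRoot z) : ∃ i < n, lam i = z := by
  rw [newtonPoly, IsRoot, eval_prod, prod_eq_zero_iff] at h
  obtain ⟨i, hi, h⟩ := h
  exact ⟨i, mem_range.1 hi, by simp at h; linarith⟩

/-- Gershgorin: a disc centred at `P k k` with radius `1 - P k k` lies in the unit disc. -/
theorem mem_Icc_of_isRoot_charpoly {P : Matrix X X ℝ} (hP : P ∈ rowStochastic ℝ X) {z : ℝ}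
    (hz : P.charpoly.IsRoot z) : z ∈ Set.Icc (-1 : ℝ) 1 := by
  rw [← charpoly_toLin', ← Module.End.hasEigenvalue_iff_isRoot_charpoly] at hz
  obtain ⟨k, hk⟩ := eigenvalue_mem_ball hz
  have hnn := fun j => nonneg_of_mem_rowStochastic hP (i := k) (j := j)
  have hsum := sum_row_of_mem_rowStochastic hP k
  rw [← add_sum_erase _ _ (mem_univ k)] at hsum
  have hnorm : ∑ j ∈ univ.erase k, ‖P k j‖ = ∑ j ∈ univ.erase k, P k j :=
    sum_congr rfl fun j _ => Real.norm_of_nonneg (hnn j)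
  rw [hnorm, Metric.mem_closedBall, Real.dist_eq, abs_le] at hk
  constructor <;> linarith [hnn k]

/-- The diagonal similarity `M ↦ (s x * M x y / s y)`, transported along an equivalence. -/
noncomputable def scaleAlgHom {n : ℕ} (e : X ≃ Fin n) (s : X → ℝ) (hs : ∀ x, 0 < s x) :
    Matrix X X ℝ →ₐ[ℝ] Matrix (Fin n) (Fin n) ℝ :=
  (reindexAlgEquiv ℝ ℝ e).toAlgHom.comp
    (AlgHom.ofLinearMap
      { toFun := fun M => diagonal s * M * diagonal (fun x => (s x)⁻¹)
        map_add' := fun M M' => by rw [mul_add, add_mul]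
        map_smul' := fun a M => by simp }
      (by
        ext i j
        simp only [LinearMap.coe_mk, AddHom.coe_mk, mul_one, diagonal_mul_diagonal]
        by_cases h : i = j
        · subst h; simp [(hs i).ne']
        · simp [h])
      (fun M M' => by
        have h : diagonal (fun x => (s x)⁻¹) * diagonal s = 1 := by
          rw [diagonal_mul_diagonal, ← diagonal_one]
          congr 1; ext x; simp [(hs x).ne']
        simp only [LinearMap.coe_mk, AddHom.coe_mk]
        calc diagonal s * (M * M') * diagonal (fun x => (s x)⁻¹)
            = diagonal s * M * 1 * M' * diagonal (fun x => (s x)⁻¹) := by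
              simp only [mul_assoc, mul_one]
          _ = _ := by rw [← h]; simp only [mul_assoc]))

theorem scaleAlgHom_apply {n : ℕ} (e : X ≃ Fin n) (s : X → ℝ) (hs : ∀ x, 0 < s x)
    (M : Matrix X X ℝ) (i j : Fin n) :
    scaleAlgHom e s hs M i j = s (e.symm i) * M (e.symm i) (e.symm j) * (s (e.symm j))⁻¹ := by
  simp [scaleAlgHom, mul_diagonal, diagonal_mul]

theorem charpoly_scaleAlgHom {n : ℕ} (e : X ≃ Fin n) (s : X → ℝ) (hs : ∀ x, 0 < s x)
    (M : Matrix X X ℝ) : (scaleAlgHom e s hs M).charpoly = M.charpoly := by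
  have h : diagonal (fun x => (s x)⁻¹) * diagonal s = 1 := by
    rw [diagonal_mul_diagonal, ← diagonal_one]
    congr 1; ext x; simp [(hs x).ne']
  have : scaleAlgHom e s hs M =
      reindex e e (diagonal s * M * diagonal (fun x => (s x)⁻¹)) := rfl
  rw [this, charpoly_reindex, charpoly_mul_comm, ← mul_assoc, h, one_mul]

theorem exists_isSpectralData_of_reversible {P : Matrix X X ℝ} (hP : P ∈ reversibleChains X) :
    ∃ lam, IsSpectralData P lam := by
  obtain ⟨hst, π, -, hπ, hrev⟩ := hP
  set s : X → ℝ := fun x => √(π x)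
  have hs : ∀ x, 0 < s x := fun x => Real.sqrt_pos.2 (hπ x)
  have hss : ∀ x, s x * s x = π x := fun x => Real.mul_self_sqrt (hπ x).le
  set e := Fintype.equivFin X
  set A := scaleAlgHom e s hs P with hAdef
  have hA : A.IsHermitian := by
    ext i j
    rw [conjTranspose_apply, star_trivial, hAdef, scaleAlgHom_apply, scaleAlgHom_apply,
      ← div_eq_mul_inv, ← div_eq_mul_inv, div_eq_div_iff (hs _).ne' (hs _).ne']
    have := hrev (e.symm i) (e.symm j)
    rw [← hss, ← hss] at this
    linarith
  have hAnn : ∀ i j, 0 ≤ A i j := fun i j => by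
    rw [hAdef, scaleAlgHom_apply]
    exact mul_nonneg (mul_nonneg (hs _).le (nonneg_of_mem_rowStochastic hst))
      (inv_nonneg.2 (hs _).le)
  have hchar : P.charpoly = newtonPoly (sortedEig A hA) (Fintype.card X) := by
    rw [← charpoly_scaleAlgHom e s hs P]
    exact charpoly_eq_newtonPoly_sortedEig A hA
  refine ⟨sortedEig A hA, hst, fun i => ?_, sortedEig_antitoneOn A hA, hchar,
    fun k hk x y => ?_⟩
  · by_cases hi : i < Fintype.card X
    · exact mem_Icc_of_isRoot_charpoly hst (hchar ▸ isRoot_newtonPoly _ hi)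
    -- Beyond the range the default value 0 still lies in the interval.
    · simp [sortedEig, hi]
  · have h := aeval_tailPoly_nonneg A hA hAnn hk (e x) (e y)
    have hA' : aeval A (tailPoly (sortedEig A hA) (Fintype.card X) (k + 1)) =
        scaleAlgHom e s hs (aeval P (tailPoly (sortedEig A hA) (Fintype.card X) (k + 1))) :=
      aeval_algHom_apply _ _ _
    rw [hA', scaleAlgHom_apply, e.symm_apply_apply, e.symm_apply_apply] at h
    rwa [mul_nonneg_iff_of_pos_right (inv_pos.2 (hs y)), mul_nonneg_iff_of_pos_left (hs x)] at h

theorem continuous_aeval_tailPoly {Y : Type*} [TopologicalSpace Y] {P : Y → Matrix X X ℝ}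
    {lam : Y → ℕ → ℝ} (hP : Continuous P) (hlam : Continuous lam) (n k : ℕ) (hk : k ≤ n) :
    Continuous fun y => aeval (P y) (tailPoly (lam y) n k) := by
  induction hk using Nat.decreasingInduction with
  | self => simpa only [tailPoly_self, map_one] using continuous_const
  | of_succ k hk ih =>
    simp only [fun y => aeval_tailPoly_eq_mul (P y) (lam y) hk]
    refine (hP.sub ?_).mul ih
    simp only [Algebra.algebraMap_eq_smul_one]
    exact ((continuous_apply k).comp hlam).smul continuous_const

/-- Projection along the compact factor of eigenvalue lists in `[-1, 1]` is a closed map, so only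
closedness of the set of pairs is needed. -/
theorem isClosed_exists_isSpectralData :
    IsClosed {P : Matrix X X ℝ | ∃ lam, IsSpectralData P lam} := by
  let S : Set ((ℕ → Set.Icc (-1 : ℝ) 1) × Matrix X X ℝ) :=
    {q | IsSpectralData q.2 fun i => q.1 i}
  have hlam : Continuous fun q : (ℕ → Set.Icc (-1 : ℝ) 1) × Matrix X X ℝ =>
      fun i => (q.1 i : ℝ) := by fun_prop
  have hent : ∀ x y, Continuous fun M : Matrix X X ℝ => M x y := fun x y => by fun_prop
  have hS : IsClosed S := by
    -- The interval condition is built into the type, and the charpoly identity is tested at each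
    -- real `z`, so every remaining condition is visibly closed.
    have : S = {q | (∀ x y, 0 ≤ q.2 x y) ∧ (∀ x, ∑ y, q.2 x y = 1) ∧
        (∀ i ∈ Set.Iio (Fintype.card X), ∀ j ∈ Set.Iio (Fintype.card X), i ≤ j →
          (q.1 j : ℝ) ≤ q.1 i) ∧
        (∀ z : ℝ, (scalar X z - q.2).det = ∏ i ∈ range (Fintype.card X), (z - q.1 i)) ∧
        (∀ k < Fintype.card X, ∀ x y,
          0 ≤ (aeval q.2 (tailPoly (fun i => (q.1 i : ℝ)) (Fintype.card X) (k + 1)) :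
            Matrix X X ℝ) x y)} := by
      ext q
      constructor
      · rintro ⟨h1, -, h3, h4, h5⟩
        rw [mem_rowStochastic_iff_sum] at h1
        refine ⟨h1.1, h1.2, fun i hi j hj => h3 hi hj, fun z => ?_, h5⟩
        rw [← eval_charpoly, h4, newtonPoly, eval_prod]
        simp
      · rintro ⟨h1, h2, h3, h4, h5⟩
        refine ⟨mem_rowStochastic_iff_sum.2 ⟨h1, h2⟩, fun i => (q.1 i).2,
          fun i hi j hj => h3 i hi j hj, Polynomial.funext fun z => ?_, h5⟩
        rw [eval_charpoly, h4, newtonPoly, eval_prod]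
        simp
    rw [this]
    simp only [Set.ofPred_and, Set.ofPred_forall]
    refine IsClosed.inter ?_ (IsClosed.inter ?_ (IsClosed.inter ?_ (IsClosed.inter ?_ ?_)))
    · exact isClosed_iInter fun x => isClosed_iInter fun y =>
        isClosed_le continuous_const ((hent x y).comp continuous_snd)
    · exact isClosed_iInter fun x => isClosed_eq
        (continuous_finsetSum _ fun y _ => (hent x y).comp continuous_snd) continuous_const
    · refine isClosed_iInter fun i => isClosed_iInter fun _ => isClosed_iInter fun j =>
        isClosed_iInter fun _ => isClosed_iInter fun _ => isClosed_le ?_ ?_ <;> fun_prop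
    · refine isClosed_iInter fun z => isClosed_eq (Continuous.matrix_det ?_) ?_
      · exact continuous_const.sub continuous_snd
      · fun_prop
    · refine isClosed_iInter fun k => isClosed_iInter fun hk => isClosed_iInter fun x =>
        isClosed_iInter fun y => isClosed_le continuous_const ((hent x y).comp ?_)
      exact continuous_aeval_tailPoly continuous_snd hlam _ _ hk
  convert isClosedMap_snd_of_compactSpace _ hS
  ext P
  constructor
  · rintro ⟨lam, h⟩
    exact ⟨(fun i => ⟨lam i, h.mem_Icc i⟩, P), h, rfl⟩
  · rintro ⟨q, hq, rfl⟩
    exact ⟨_, hq⟩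

theorem exists_isSpectralData {P : Matrix X X ℝ} (hP : P ∈ closure (reversibleChains X)) :
    ∃ lam, IsSpectralData P lam :=
  closure_minimal (fun _ h => exists_isSpectralData_of_reversible h)
    isClosed_exists_isSpectralData hP

theorem mul_self_mem_reversibleChains {P : Matrix X X ℝ} (hP : P ∈ reversibleChains X) :
    P * P ∈ reversibleChains X := by
  obtain ⟨hst, π, ⟨hπ1, hπ2⟩, hpos, hrev⟩ := hP
  refine ⟨mul_mem hst hst, π, ⟨hπ1, ?_⟩, hpos, fun x y => ?_⟩
  · rw [← vecMul_vecMul, hπ2, hπ2]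
  · rw [mul_apply, mul_apply, mul_sum, mul_sum]
    refine sum_congr rfl fun z _ => ?_
    linear_combination P z y * hrev x z + P z x * hrev z y

theorem mul_self_mem_closure {P : Matrix X X ℝ} (hP : P ∈ closure (reversibleChains X)) :
    P * P ∈ closure (reversibleChains X) :=
  map_mem_closure (f := fun M : Matrix X X ℝ => M * M) (continuous_id.mul continuous_id) hP
    fun _ h => mul_self_mem_reversibleChains h

end MarkovMixing

namespace MarkovMixing

open Polynomial Finset Matrix

/-! ### Total variation distance -/

section

variable {X : Type*} [Fintype X]

theorem tvDist_self (μ : X → ℝ) : tvDist μ μ = 0 := by simp [tvDist]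

theorem tvDist_le_one {μ ν : X → ℝ} (hμ : μ ∈ stdSimplex ℝ X) (hν : ν ∈ stdSimplex ℝ X) :
    tvDist μ ν ≤ 1 := by
  have : ∑ x, |μ x - ν x| ≤ ∑ x, (μ x + ν x) :=
    sum_le_sum fun x _ => abs_le.2 ⟨by linarith [hμ.1 x, hν.1 x], by linarith [hμ.1 x, hν.1 x]⟩
  rw [sum_add_distrib, hμ.2, hν.2] at this
  rw [tvDist]; linarith

theorem tvDist_convex_le {a : ℝ} (ha0 : 0 ≤ a) (ha1 : a ≤ 1) (μ μ' ν : X → ℝ) :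
    tvDist (fun x => a * μ x + (1 - a) * μ' x) ν ≤ a * tvDist μ ν + (1 - a) * tvDist μ' ν := by
  have : ∑ x, |a * μ x + (1 - a) * μ' x - ν x| ≤
      a * ∑ x, |μ x - ν x| + (1 - a) * ∑ x, |μ' x - ν x| := by
    rw [mul_sum, mul_sum, ← sum_add_distrib]
    refine sum_le_sum fun x _ => ?_
    calc |a * μ x + (1 - a) * μ' x - ν x|
        = |a * (μ x - ν x) + (1 - a) * (μ' x - ν x)| := by ring_nf
      _ ≤ |a * (μ x - ν x)| + |(1 - a) * (μ' x - ν x)| := abs_add_le _ _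
      _ = _ := by rw [abs_mul, abs_mul, abs_of_nonneg ha0, abs_of_nonneg (sub_nonneg.2 ha1)]
  simp only [tvDist]
  linarith

theorem prod_one_sub_pos {lam : ℕ → ℝ} (hlt : ∀ i, 1 ≤ i → i < Fintype.card X → lam i < 1) (k : ℕ) :
    0 < ∏ i ∈ Ico (k + 1) (Fintype.card X), (1 - lam i) :=
  Finset.prod_pos fun i hi => by
    rw [mem_Ico] at hi
    linarith [hlt i (by omega) hi.2]

end

variable {X : Type*} [Fintype X] [DecidableEq X]

/-! ### Eigenvectors at the eigenvalue one -/

theorem aeval_mulVec_of_mulVec_eq {P : Matrix X X ℝ} {f : X → ℝ} (hf : P *ᵥ f = f) (q : ℝ[X]) :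
    aeval P q *ᵥ f = q.eval 1 • f := by
  have hpow : ∀ k : ℕ, P ^ k *ᵥ f = f := fun k => by
    induction k with
    | zero => simp
    | succ k ih => rw [pow_succ, ← mulVec_mulVec, hf, ih]
  induction q using Polynomial.induction_on' with
  | add p q hp hq => rw [map_add, add_mulVec, hp, hq, eval_add, add_smul]
  | monomial k a =>
    rw [aeval_monomial, ← mulVec_mulVec, hpow, Algebra.algebraMap_eq_smul_one, smul_mulVec]
    simp

theorem vecMul_aeval_of_vecMul_eq {P : Matrix X X ℝ} {f : X → ℝ} (hf : f ᵥ* P = f) (q : ℝ[X]) :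
    f ᵥ* aeval P q = q.eval 1 • f := by
  have hpow : ∀ k : ℕ, f ᵥ* P ^ k = f := fun k => by
    induction k with
    | zero => simp
    | succ k ih => rw [pow_succ, ← vecMul_vecMul, ih, hf]
  induction q using Polynomial.induction_on' with
  | add p q hp hq => rw [map_add, vecMul_add, hp, hq, eval_add, add_smul]
  | monomial k a =>
    rw [aeval_monomial, ← vecMul_vecMul, Algebra.algebraMap_eq_smul_one, vecMul_smul, vecMul_one,
      smul_vecMul, hpow]
    simp

/-! ### Normalized products and the stationary distribution -/

namespace IsSpectralData

variable {P : Matrix X X ℝ} {lam : ℕ → ℝ}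

theorem mulVec_one (h : IsSpectralData P lam) : P *ᵥ (1 : X → ℝ) = 1 :=
  (mem_rowStochastic.1 h.stochastic).2

theorem lam_zero [Nonempty X] (h : IsSpectralData P lam) : lam 0 = 1 := by
  have hroot : P.charpoly.IsRoot 1 := by
    rw [← charpoly_toLin', ← Module.End.hasEigenvalue_iff_isRoot_charpoly]
    refine Module.End.hasEigenvalue_of_hasEigenvector (x := (1 : X → ℝ))
      ⟨Module.End.mem_eigenspace_iff.2 ?_, one_ne_zero⟩
    rw [toLin'_apply, h.mulVec_one, one_smul]
  rw [h.charpoly_eq] at hroot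
  obtain ⟨i, hi, h1⟩ := exists_eq_of_isRoot_newtonPoly hroot
  exact le_antisymm (h.mem_Icc 0).2 (h1 ▸ h.antitoneOn (Fintype.card_pos) hi (Nat.zero_le i))

/-- The normalized products `∏ k ≤ i, (P - lam i) / (1 - lam i)`. -/
noncomputable def localEq (P : Matrix X X ℝ) (lam : ℕ → ℝ) (k : ℕ) : Matrix X X ℝ :=
  (∏ i ∈ Ico k (Fintype.card X), (1 - lam i))⁻¹ • aeval P (tailPoly lam (Fintype.card X) k)

theorem localEq_card (P : Matrix X X ℝ) (lam : ℕ → ℝ) : localEq P lam (Fintype.card X) = 1 := by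
  simp [localEq, tailPoly_self]

theorem localEq_mem_rowStochastic (h : IsSpectralData P lam)
    (hlt : ∀ i, 1 ≤ i → i < Fintype.card X → lam i < 1) {k : ℕ} (hk : k < Fintype.card X) :
    localEq P lam (k + 1) ∈ rowStochastic ℝ X := by
  rw [mem_rowStochastic]
  have hpos := prod_one_sub_pos hlt k
  refine ⟨fun x y => ?_, ?_⟩
  · exact mul_nonneg (inv_nonneg.2 hpos.le) (h.nonneg k hk x y)
  · rw [localEq, smul_mulVec, aeval_mulVec_of_mulVec_eq h.mulVec_one, eval_tailPoly, smul_smul,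
      inv_mul_cancel₀ hpos.ne', one_smul]

theorem mul_localEq (hlt : ∀ i, 1 ≤ i → i < Fintype.card X → lam i < 1) {k : ℕ} (hk1 : 1 ≤ k)
    (hk : k < Fintype.card X) :
    P * localEq P lam (k + 1) =
      lam k • localEq P lam (k + 1) + (1 - lam k) • localEq P lam k := by
  have h1 : 1 - lam k ≠ 0 := by linarith [hlt k hk1 hk]
  have h2 := (prod_one_sub_pos hlt k).ne'
  rw [localEq, localEq, aeval_tailPoly_eq_mul P lam hk, prod_eq_prod_Ico_succ_bot hk, mul_inv,
    ← smul_smul, smul_inv_smul₀ h1, Algebra.algebraMap_eq_smul_one, sub_mul, smul_mul_assoc,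
    one_mul, mul_smul_comm]
  module

/-- Since `lam 0 = 1`, Cayley–Hamilton says that `P - 1` annihilates the remaining product. -/
theorem mul_localEq_one [Nonempty X] (h : IsSpectralData P lam) :
    P * localEq P lam 1 = localEq P lam 1 := by
  have h0 : aeval P (tailPoly lam (Fintype.card X) 0) = 0 := by
    rw [tailPoly_zero, ← h.charpoly_eq, aeval_self_charpoly]
  rw [aeval_tailPoly_eq_mul P lam Fintype.card_pos, h.lam_zero, map_one, sub_mul, one_mul,
    sub_eq_zero] at h0
  rw [localEq, mul_smul_comm, h0]

theorem localEq_one_mul [Nonempty X] (h : IsSpectralData P lam) :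
    localEq P lam 1 * P = localEq P lam 1 := by
  conv_rhs => rw [← h.mul_localEq_one]
  rw [localEq, mul_smul_comm, smul_mul_assoc]
  congr 1
  have := congrArg (aeval P) (mul_comm (tailPoly lam (Fintype.card X) 1) Polynomial.X)
  simpa using this

/-- The charpoly has 1 as a simple root, so the eigenspace at 1 is a line, spanned by the constants.
-/
theorem eq_of_mulVec_eq [Nonempty X] (h : IsSpectralData P lam)
    (hlt : ∀ i, 1 ≤ i → i < Fintype.card X → lam i < 1) {f : X → ℝ} (hf : P *ᵥ f = f) (x y : X) :
    f x = f y := by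
  have hmult : P.charpoly.rootMultiplicity 1 ≤ 1 := by
    rw [rootMultiplicity_le_iff P.charpoly_monic.ne_zero, h.charpoly_eq,
      newtonPoly_eq_mul_tailPoly lam Fintype.card_pos, h.lam_zero, pow_succ, pow_one]
    intro hdvd
    have := (mul_dvd_mul_iff_left (X_sub_C_ne_zero (1 : ℝ))).1 hdvd
    rw [dvd_iff_isRoot, IsRoot, eval_tailPoly] at this
    exact (prod_one_sub_pos hlt 0).ne' this
  have hfin := (LinearMap.finrank_eigenspace_le (toLin' P) 1).trans
    ((charpoly_toLin' P).symm ▸ hmult)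
  obtain ⟨v, hv⟩ := finrank_le_one_iff.1 hfin
  obtain ⟨a, ha⟩ := hv ⟨1, Module.End.mem_eigenspace_iff.2 (by
    rw [toLin'_apply, h.mulVec_one, one_smul])⟩
  obtain ⟨b, hb⟩ := hv ⟨f, Module.End.mem_eigenspace_iff.2 (by rw [toLin'_apply, hf, one_smul])⟩
  have ha' : ∀ z, a * (v : X → ℝ) z = 1 := fun z => congrFun (congrArg Subtype.val ha) z
  have hb' : ∀ z, b * (v : X → ℝ) z = f z := fun z => congrFun (congrArg Subtype.val hb) z
  have ha0 : a ≠ 0 := fun h0 => by simpa [h0] using ha' x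
  have hvxy : (v : X → ℝ) x = (v : X → ℝ) y :=
    mul_left_cancel₀ ha0 ((ha' x).trans (ha' y).symm)
  rw [← hb', ← hb', hvxy]

theorem localEq_one_row_eq [Nonempty X] (h : IsSpectralData P lam)
    (hlt : ∀ i, 1 ≤ i → i < Fintype.card X → lam i < 1) (x x' : X) :
    localEq P lam 1 x = localEq P lam 1 x' := by
  ext y
  refine h.eq_of_mulVec_eq hlt (f := fun x => localEq P lam 1 x y) ?_ x x'
  ext z
  exact congrFun (congrFun h.mul_localEq_one z) y

theorem localEq_one_row_eq_of_isStationary [Nonempty X] (h : IsSpectralData P lam)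
    (hlt : ∀ i, 1 ≤ i → i < Fintype.card X → lam i < 1) {π : X → ℝ} (hπ : IsStationary P π)
    (x : X) : localEq P lam 1 x = π := by
  have h1 : π ᵥ* localEq P lam 1 = π := by
    rw [localEq, vecMul_smul, vecMul_aeval_of_vecMul_eq hπ.2, eval_tailPoly, smul_smul,
      inv_mul_cancel₀ (prod_one_sub_pos hlt 0).ne', one_smul]
  ext y
  rw [← h1]
  simp only [vecMul, dotProduct]
  rw [sum_congr rfl fun z _ => by rw [h.localEq_one_row_eq hlt z x], ← sum_mul, hπ.1.2, one_mul]

theorem exists_isStationary [Nonempty X] (h : IsSpectralData P lam)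
    (hlt : ∀ i, 1 ≤ i → i < Fintype.card X → lam i < 1) : ∃ π, IsStationary P π := by
  obtain ⟨x⟩ := ‹Nonempty X›
  have : Nonempty X := ⟨x⟩
  have hT := h.localEq_mem_rowStochastic hlt (k := 0) Fintype.card_pos
  refine ⟨localEq P lam 1 x, ⟨fun y => nonneg_of_mem_rowStochastic hT,
    sum_row_of_mem_rowStochastic hT x⟩, ?_⟩
  ext y
  exact congrFun (congrFun h.localEq_one_mul x) y

end IsSpectralData

/-! ### Total variation bounds -/

-- From level `j + 2`, level 1 is missed by time `t` only if at most `j` deaths occur. The bound is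
-- Markov's inequality for `c⁻¹` raised to the number of deaths, compared with a binomial variable
-- of success probability `1 - β`.
open IsSpectralData in
theorem tvDist_pow_mul_localEq_le [Nonempty X] {P : Matrix X X ℝ} {lam : ℕ → ℝ}
    (h : IsSpectralData P lam) {β : ℝ} (hβ : β < 1)
    (hlam : ∀ i, 1 ≤ i → i < Fintype.card X → 0 ≤ lam i ∧ lam i ≤ β) {π : X → ℝ}
    (hπ : IsStationary P π) {c : ℝ} (hc : 1 ≤ c) (t j : ℕ) (hj : j + 2 ≤ Fintype.card X) (x : X) :
    tvDist ((P ^ t * localEq P lam (j + 2)) x) π ≤ c ^ j * (β + (1 - β) * c⁻¹) ^ t := by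
  have hlt : ∀ i, 1 ≤ i → i < Fintype.card X → lam i < 1 := fun i h1 h2 =>
    (hlam i h1 h2).2.trans_lt hβ
  have hc0 : 0 < c := by linarith
  have hci : 0 < c⁻¹ := inv_pos.2 hc0
  have hci1 : c⁻¹ ≤ 1 := inv_le_one_of_one_le₀ hc
  have hβ0 : 0 ≤ β := (hlam 1 le_rfl (by omega)).1.trans (hlam 1 le_rfl (by omega)).2
  set ρ := β + (1 - β) * c⁻¹ with hρ
  have hρβ : β ≤ ρ := by rw [hρ]; nlinarith
  have hρ0 : 0 ≤ ρ := hβ0.trans hρβ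
  induction t generalizing j with
  | zero =>
    rw [pow_zero, pow_zero, one_mul, mul_one]
    have hT := h.localEq_mem_rowStochastic hlt (k := j + 1) (by omega)
    exact (tvDist_le_one ⟨fun y => nonneg_of_mem_rowStochastic hT,
      sum_row_of_mem_rowStochastic hT x⟩ hπ.1).trans (one_le_pow₀ hc)
  | succ t ih =>
    obtain ⟨hl0, hl1⟩ := hlam (j + 1) (by omega) (by omega)
    have hrec : (P ^ (t + 1) * localEq P lam (j + 2)) x = fun y =>
        lam (j + 1) * (P ^ t * localEq P lam (j + 2)) x y +
          (1 - lam (j + 1)) * (P ^ t * localEq P lam (j + 1)) x y := by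
      rw [pow_succ, mul_assoc, mul_localEq hlt (by omega) (by omega), mul_add, mul_smul_comm,
        mul_smul_comm]
      rfl
    rw [hrec]
    refine (tvDist_convex_le hl0 (by linarith) _ _ _).trans ?_
    have hA := mul_le_mul_of_nonneg_left (ih j hj) hl0
    have hρt : 0 ≤ ρ ^ t := pow_nonneg hρ0 t
    rcases j with _ | j
    -- At the lowest case a death leads to `L 1`, which is already stationary and contributes no
    -- distance.
    · have hB : tvDist ((P ^ t * localEq P lam (0 + 1)) x) π = 0 := by
        have : P ^ t * localEq P lam (0 + 1) = localEq P lam 1 := by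
          clear ih hrec hA hρt
          induction t with
          | zero => simp
          | succ t ih => rw [pow_succ, mul_assoc, zero_add, h.mul_localEq_one, ih]
        rw [this, h.localEq_one_row_eq_of_isStationary hlt hπ, tvDist_self]
      rw [hB, mul_zero, add_zero]
      rw [pow_zero, one_mul] at hA ⊢
      refine hA.trans ?_
      rw [pow_succ, mul_comm]
      exact mul_le_mul_of_nonneg_left (hl1.trans hρβ) hρt
    · have hB := mul_le_mul_of_nonneg_left (ih j (by omega))
        (show 0 ≤ 1 - lam (j + 1 + 1) by linarith)
      refine (add_le_add hA hB).trans ?_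
      have hcj : 0 ≤ c ^ (j + 1) * ρ ^ t := by positivity
      have hle : lam (j + 1 + 1) + (1 - lam (j + 1 + 1)) * c⁻¹ ≤ ρ := by
        rw [hρ]; nlinarith
      calc lam (j + 1 + 1) * (c ^ (j + 1) * ρ ^ t) + (1 - lam (j + 1 + 1)) * (c ^ j * ρ ^ t)
          = c ^ (j + 1) * ρ ^ t * (lam (j + 1 + 1) + (1 - lam (j + 1 + 1)) * c⁻¹) := by
            rw [pow_succ]; field_simp
        _ ≤ c ^ (j + 1) * ρ ^ t * ρ := mul_le_mul_of_nonneg_left hle hcj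
        _ = c ^ (j + 1) * ρ ^ (t + 1) := by ring

/-- A Chernoff-type estimate with an explicit threshold. -/
theorem exists_one_le_pow_mul_exp_le (m : ℕ) {L μ : ℝ} (hL : 0 < L)
    (hμ : m + 2 * L + √(2 * m * L) ≤ μ) :
    ∃ c : ℝ, 1 ≤ c ∧ c ^ m * Real.exp (-(μ * (1 - c⁻¹))) ≤ Real.exp (-L) := by
  rcases Nat.eq_zero_or_pos m with rfl | hm
  · refine ⟨2, by norm_num, ?_⟩
    simp at hμ
    rw [pow_zero, one_mul]
    exact Real.exp_le_exp.2 (by norm_num; linarith)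
  · have hm' : (0 : ℝ) < m := Nat.cast_pos.2 hm
    set s := √(2 * m * L)
    have hs0 : 0 ≤ s := Real.sqrt_nonneg _
    have hs : s * s = 2 * m * L := Real.mul_self_sqrt (by positivity)
    have hμ0 : 0 < μ := by linarith
    have hc : 1 ≤ μ / m := by rw [le_div_iff₀ hm']; linarith
    have hc0 : 0 < μ / m := by positivity
    -- This `c` minimizes `m * log c - μ * (1 - c⁻¹)`.
    refine ⟨μ / m, hc, ?_⟩
    have hlog : Real.log (μ / m) ≤ (μ / m - (μ / m)⁻¹) / 2 := by
      rw [← Real.sinh_log hc0]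
      exact Real.self_le_sinh_iff.2 (Real.log_nonneg hc)
    have hpow : (μ / m) ^ m = Real.exp (m * Real.log (μ / m)) := by
      rw [mul_comm, Real.exp_mul, Real.exp_log hc0, Real.rpow_natCast]
    rw [hpow, ← Real.exp_add, Real.exp_le_exp]
    have h1 : (m : ℝ) * Real.log (μ / m) ≤ (μ - m ^ 2 / μ) / 2 := by
      refine (mul_le_mul_of_nonneg_left hlog hm'.le).trans (le_of_eq ?_)
      field_simp
    have h2 : μ * (1 - (μ / m)⁻¹) = μ - m := by field_simp
    -- The threshold is chosen for this: the exact root `m + L + √(2mL + L²)` of the quadratic is at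
    -- most `m + 2L + √(2mL)`.
    have h3 : 2 * L * μ ≤ (μ - m) ^ 2 := by nlinarith
    have h4 : 2 * L ≤ μ - 2 * m + m ^ 2 / μ := by
      rw [show μ - 2 * m + m ^ 2 / μ = (μ - m) ^ 2 / μ by field_simp; ring,
        le_div_iff₀ hμ0]
      exact h3
    rw [h2]
    linarith

/-- Mixing at all times beyond the explicit threshold, for nonnegative eigenvalues. -/
theorem mem_mixedTimes_of_le {P : Matrix X X ℝ} {lam : ℕ → ℝ}
    (h : IsSpectralData P lam) {m : ℕ} (hcard : Fintype.card X = m + 2) {β : ℝ} (hβ : β < 1)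
    (hlam : ∀ i, 1 ≤ i → i < Fintype.card X → 0 ≤ lam i ∧ lam i ≤ β) {π : X → ℝ}
    (hπ : IsStationary P π) {ε : ℝ} (hε0 : 0 < ε) (hε1 : ε < 1) {t : ℕ}
    (ht : m + 2 * Real.log ε⁻¹ + √(2 * m * Real.log ε⁻¹) ≤ t * (1 - β)) :
    t ∈ mixedTimes P π ε := by
  intro x
  have : Nonempty X := ⟨x⟩
  have hL : 0 < Real.log ε⁻¹ := Real.log_pos ((one_lt_inv₀ hε0).2 hε1)
  obtain ⟨c, hc, hle⟩ := exists_one_le_pow_mul_exp_le m hL ht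
  have hbound := tvDist_pow_mul_localEq_le h hβ hlam hπ hc t m hcard.ge x
  rw [← hcard, IsSpectralData.localEq_card, mul_one] at hbound
  refine hbound.trans ?_
  rw [Real.log_inv, neg_neg, Real.exp_log hε0] at hle
  refine le_trans ?_ hle
  have hc0 : 0 < c := by linarith
  have hci : 0 < c⁻¹ := inv_pos.2 hc0
  have hβ0 : 0 ≤ β := (hlam 1 le_rfl (by omega)).1.trans (hlam 1 le_rfl (by omega)).2
  refine mul_le_mul_of_nonneg_left ?_ (by positivity)
  have hρ0 : 0 ≤ β + (1 - β) * c⁻¹ := by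
    have := mul_nonneg (sub_nonneg.2 hβ.le) hci.le
    linarith
  have hexp : β + (1 - β) * c⁻¹ ≤ Real.exp (-((1 - β) * (1 - c⁻¹))) := by
    have := Real.add_one_le_exp (-((1 - β) * (1 - c⁻¹)))
    linarith
  refine (pow_le_pow_left₀ hρ0 hexp t).trans (le_of_eq ?_)
  rw [← Real.exp_nat_mul]
  ring_nf

theorem exists_mem_mixedTimes_le {P : Matrix X X ℝ} {lam : ℕ → ℝ}
    (h : IsSpectralData P lam) {N : ℕ} (hN : Fintype.card X = N) (hN2 : 2 ≤ N) {β : ℝ}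
    (hβ : β < 1) (hlam : ∀ i, 1 ≤ i → i < Fintype.card X → 0 ≤ lam i ∧ lam i ≤ β) {π : X → ℝ}
    (hπ : IsStationary P π) {ε : ℝ} (hε0 : 0 < ε) (hε1 : ε < 1) :
    ∃ t ∈ mixedTimes P π ε, (t : ℝ) ≤
      ((N : ℝ) + 2 * Real.log ε⁻¹ - 1 + √(2 * ((N : ℝ) - 2) * Real.log ε⁻¹)) *
        (1 / (1 - β)) := by
  obtain ⟨m, rfl⟩ : ∃ m, N = m + 2 := ⟨N - 2, by omega⟩
  have hβ0 : 0 ≤ β := (hlam 1 le_rfl (by omega)).1.trans (hlam 1 le_rfl (by omega)).2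
  have hL : 0 < Real.log ε⁻¹ := Real.log_pos ((one_lt_inv₀ hε0).2 hε1)
  have hcast : ((m + 2 : ℕ) : ℝ) - 2 = m := by push_cast; ring
  rw [hcast]
  set B := ((m + 2 : ℕ) : ℝ) + 2 * Real.log ε⁻¹ - 1 + √(2 * (m : ℝ) * Real.log ε⁻¹) with hB
  have hB0 : 0 ≤ B := by
    have := Real.sqrt_nonneg (2 * (m : ℝ) * Real.log ε⁻¹)
    have hm : (0 : ℝ) ≤ m := Nat.cast_nonneg m
    rw [hB]; push_cast; linarith
  have hp : 0 < 1 - β := by linarith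
  -- Rounding down costs less than one step, hence less than `1 - β ≤ 1` after rescaling; this is
  -- why `B` has `N - 1` where the Chernoff threshold has `m = N - 2`.
  refine ⟨⌊B * (1 / (1 - β))⌋₊, mem_mixedTimes_of_le h hN hβ hlam hπ hε0 hε1 ?_,
    Nat.floor_le (by positivity)⟩
  have hfl := Nat.lt_floor_add_one (B * (1 / (1 - β)))
  have h1 := mul_lt_mul_of_pos_right hfl hp
  rw [mul_assoc, one_div, inv_mul_cancel₀ hp.ne', mul_one, add_mul, one_mul, hB] at h1
  push_cast at h1
  rw [one_div, hB]
  push_cast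
  linarith

/-! ### Eigenvalues -/

theorem eigenvalues_eq_cons [Nonempty X] {P : Matrix X X ℝ} {lam : ℕ → ℝ}
    (h : IsSpectralData P lam) :
    eigenvalues P = 1 ::ₘ (Ico 1 (Fintype.card X)).val.map fun i => (lam i : ℂ) := by
  have hroots : eigenvalues P = (range (Fintype.card X)).val.map fun i => (lam i : ℂ) := by
    rw [eigenvalues, charpoly_map, h.charpoly_eq, newtonPoly, Polynomial.map_prod]
    simp only [Polynomial.map_sub, map_X, map_C]
    rw [← roots_multiset_prod_X_sub_C (Multiset.map _ _), Multiset.map_map]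
    rfl
  have hins : range (Fintype.card X) = insert 0 (Ico 1 (Fintype.card X)) := by
    ext i
    have : 0 < Fintype.card X := Fintype.card_pos
    simp only [mem_range, mem_insert, mem_Ico]
    omega
  rw [hroots, hins, insert_val_of_notMem (by simp), Multiset.map_cons, h.lam_zero]
  simp

theorem abs_lam_le_betaStar [Nonempty X] {P : Matrix X X ℝ} {lam : ℕ → ℝ}
    (h : IsSpectralData P lam) {i : ℕ} (hi1 : 1 ≤ i) (hi : i < Fintype.card X) :
    |lam i| ≤ betaStar P := by
  rw [betaStar, eigenvalues_eq_cons h, Multiset.erase_cons_head, Multiset.map_map]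
  have : ‖(lam i : ℂ)‖₊ ≤ (Multiset.map ((fun z : ℂ => ‖z‖₊) ∘ fun i => (lam i : ℂ))
      (Ico 1 (Fintype.card X)).val).sup :=
    Multiset.le_sup (Multiset.mem_map.2 ⟨i, by simp; omega, rfl⟩)
  have h2 := NNReal.coe_le_coe.2 this
  rwa [coe_nnnorm, Complex.norm_real, Real.norm_eq_abs] at h2

/-- Factor `det (z² - P²) = det (z - P) * det (z + P)`; agreement at all squares `z²` forces
equality of polynomials. -/
theorem newtonPoly_sq_eq {P : Matrix X X ℝ} {lam lam' : ℕ → ℝ}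
    (h : IsSpectralData P lam) (h' : IsSpectralData (P * P) lam') :
    newtonPoly lam' (Fintype.card X) = newtonPoly (fun i => lam i ^ 2) (Fintype.card X) := by
  have hsq : ∀ z : ℝ, (newtonPoly lam' (Fintype.card X)).eval (z ^ 2) =
      (newtonPoly (fun i => lam i ^ 2) (Fintype.card X)).eval (z ^ 2) := by
    intro z
    have hminus := eval_charpoly P z
    have hplus := eval_charpoly P (-z)
    rw [h.charpoly_eq, newtonPoly, eval_prod] at hminus hplus
    rw [← h'.charpoly_eq, eval_charpoly]
    have hfac : scalar X (z ^ 2) - P * P =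
        (scalar X z - P) * (-(scalar X (-z) - P)) := by
      have hc : P * scalar X z = scalar X z * P :=
        (scalar_commute z (fun _ => Commute.all _ _) P).eq.symm
      rw [map_neg, neg_sub, sub_neg_eq_add, sub_mul, mul_add, mul_add, hc, pow_two, map_mul]
      abel
    rw [hfac, det_mul, det_neg, ← hminus, ← hplus, newtonPoly, eval_prod,
      ← card_range (Fintype.card X), ← prod_const, card_range, ← prod_mul_distrib,
      ← prod_mul_distrib]
    refine prod_congr rfl fun i _ => ?_
    simp
    ring
  refine eq_of_infinite_eval_eq _ _ ((Set.Ici_infinite (0 : ℝ)).mono fun y hy => ?_)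
  have := hsq √y
  rwa [Real.sq_sqrt hy] at this

/-- The factor `X - 1` is cancelled first, so that `j = 0` is excluded even when some other square
equals 1. -/
theorem exists_lam_sq_eq [Nonempty X] {P : Matrix X X ℝ} {lam lam' : ℕ → ℝ}
    (h : IsSpectralData P lam) (h' : IsSpectralData (P * P) lam') {i : ℕ} (hi1 : 1 ≤ i)
    (hi : i < Fintype.card X) : ∃ j, 1 ≤ j ∧ j < Fintype.card X ∧ lam' i = lam j ^ 2 := by
  have heq := newtonPoly_sq_eq h h'
  rw [newtonPoly_eq_mul_tailPoly _ Fintype.card_pos, newtonPoly_eq_mul_tailPoly _ Fintype.card_pos,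
    h.lam_zero, h'.lam_zero, one_pow] at heq
  have htail := mul_left_cancel₀ (X_sub_C_ne_zero (1 : ℝ)) heq
  have h0 := congrArg (eval (lam' i)) htail
  rw [eval_tailPoly, eval_tailPoly, prod_eq_zero (mem_Ico.2 ⟨hi1, hi⟩) (sub_self _)] at h0
  obtain ⟨j, hj, hj0⟩ := prod_eq_zero_iff.1 h0.symm
  rw [mem_Ico] at hj
  exact ⟨j, hj.1, hj.2, sub_eq_zero.1 hj0⟩

theorem mem_mixedTimes_two_mul {P : Matrix X X ℝ} {π : X → ℝ} {ε : ℝ} {t : ℕ}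
    (ht : t ∈ mixedTimes (P * P) π ε) : 2 * t ∈ mixedTimes P π ε := by
  intro x
  rw [pow_mul, pow_two]
  exact ht x

end MarkovMixing

/-! ### The mixing time bounds -/

theorem theorem1p3 {X : Type*} [Fintype X] [DecidableEq X] (N : ℕ)
    (hN : Fintype.card X = N) (hN2 : 2 ≤ N) (P : Matrix X X ℝ)
    (hP : P ∈ closure (MarkovMixing.reversibleChains X))
    (hβ : MarkovMixing.betaStar P < 1) :
    ∃ π : X → ℝ, MarkovMixing.IsStationary P π ∧
      (∀ π' : X → ℝ, MarkovMixing.IsStationary P π' → π' = π) ∧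
      ∀ ε : ℝ, 0 < ε → ε < 1 →
        (MarkovMixing.mixedTimes P π ε).Nonempty ∧
        (MarkovMixing.tMix P π ε : ℝ) ≤
          2 * ((N : ℝ) + 2 * Real.log ε⁻¹ - 1 + √(2 * ((N : ℝ) - 2) * Real.log ε⁻¹)) *
            MarkovMixing.tRel P ∧
        ((∀ z ∈ MarkovMixing.eigenvalues P, ∃ r : ℝ, 0 ≤ r ∧ z = (r : ℂ)) →
          (MarkovMixing.tMix P π ε : ℝ) ≤
            ((N : ℝ) + 2 * Real.log ε⁻¹ - 1 + √(2 * ((N : ℝ) - 2) * Real.log ε⁻¹)) *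
              MarkovMixing.tRel P) := by
  open MarkovMixing in
  have : Nonempty X := Fintype.card_pos_iff.1 (by omega)
  obtain ⟨lam, h⟩ := exists_isSpectralData hP
  obtain ⟨lam', h'⟩ := exists_isSpectralData (mul_self_mem_closure hP)
  have habs : ∀ i, 1 ≤ i → i < Fintype.card X → |lam i| ≤ betaStar P := fun i h1 h2 =>
    abs_lam_le_betaStar h h1 h2
  have hlt : ∀ i, 1 ≤ i → i < Fintype.card X → lam i < 1 := fun i h1 h2 =>
    ((le_abs_self _).trans (habs i h1 h2)).trans_lt hβ
  have hlam' : ∀ i, 1 ≤ i → i < Fintype.card X → 0 ≤ lam' i ∧ lam' i ≤ betaStar P := by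
    intro i h1 h2
    obtain ⟨j, hj1, hj2, hj⟩ := exists_lam_sq_eq h h' h1 h2
    rw [hj]
    refine ⟨sq_nonneg _, ?_⟩
    have hj3 := habs j hj1 hj2
    rw [← sq_abs]
    -- Squaring a modulus at most `betaStar P < 1` only decreases it, so the same relaxation time
    -- serves for `P * P`.
    nlinarith [abs_nonneg (lam j)]
  obtain ⟨π, hπ⟩ := h.exists_isStationary hlt
  have hπ' : IsStationary (P * P) π := ⟨hπ.1, by rw [← Matrix.vecMul_vecMul, hπ.2, hπ.2]⟩
  refine ⟨π, hπ, fun π' hπ'' => ?_, fun ε hε0 hε1 => ?_⟩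
  · obtain ⟨x⟩ := ‹Nonempty X›
    have : Nonempty X := ⟨x⟩
    rw [← h.localEq_one_row_eq_of_isStationary hlt hπ'' x,
      h.localEq_one_row_eq_of_isStationary hlt hπ x]
  · obtain ⟨t, ht, hle⟩ := exists_mem_mixedTimes_le h' hN hN2 hβ hlam' hπ' hε0 hε1
    have ht2 := mem_mixedTimes_two_mul ht
    refine ⟨⟨_, ht2⟩, ?_, fun hnn => ?_⟩
    · have h1 : (tMix P π ε : ℝ) ≤ ((2 * t : ℕ) : ℝ) := Nat.cast_le.2 (Nat.sInf_le ht2)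
      push_cast at h1
      rw [tRel, mul_assoc]
      linarith
    · have hlam : ∀ i, 1 ≤ i → i < Fintype.card X → 0 ≤ lam i ∧ lam i ≤ betaStar P := by
        intro i h1 h2
        refine ⟨?_, (le_abs_self _).trans (habs i h1 h2)⟩
        obtain ⟨r, hr, hz⟩ := hnn (lam i) (by
          rw [eigenvalues_eq_cons h]
          exact Multiset.mem_cons_of_mem (Multiset.mem_map.2 ⟨i, by simp; omega, rfl⟩))
        rwa [Complex.ofReal_inj.1 hz]
      obtain ⟨t, ht, hle⟩ := exists_mem_mixedTimes_le h hN hN2 hβ hlam hπ hε0 hε1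
      exact (Nat.cast_le.2 (Nat.sInf_le ht)).trans hle
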